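/- All manifolds are smooth, Hausdorff and second countable, and submanifolds are embedded. **Definitions.** An $n$-dimensional orbifold chart $(U,\widetilde U/\Gamma,\pi)$ on a space $X$ consists of an open set $U\subset X$, a connected $n$-manifold $\widetilde U$, a finite group $\Gamma$ acting smoothly and effectively on $\widetilde U$, and a continuous $\Gamma$-invariant map $\pi\colon\widetilde U\to U$ inducing a homeomorphism $\widetilde U/\Gamma\to U$. An injection of charts is a smooth embedding $\lambda\colon\widetilde U_1\to\widetilde U_2$ with $\pi_2\circ\lambda=\pi_1$; two charts are compatible if every point of $U_1\cap U_2$ lies in the support $W\subset U_1\cap U_2$ of a chart which has injections to both. An orbifold atlas on a second countable Hausdorff space is a set of pairwise compatible charts whose supports cover the space; the maximal atlas it determines consists of all charts compatible with all of its charts. Let a group $\Gamma$ act on a manifold $M$ and let $\Delta\subset\Gamma$ be a subgroup. A $\Delta$-invariant submanifold $N\subset M$ is a *$\Delta$-submanifold* if for all $g\in\Gamma$ and $p\in N$ with $gp\in N$ there is $\delta\in\Delta$ with $\delta p=gp$. A subset $Y$ of an orbifold $(X,\mathcal A)$ is a *$k$-dimensional suborbifold* if there are charts $(U_j,\widetilde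 U_j/\Gamma_j,\pi_j)_{j\in J}$ in $\mathcal A$, subgroups $\Delta_j\subset\Gamma_j$ and connected $k$-dimensional $\Delta_j$-submanifolds $\widetilde V_j\subset\widetilde U_j$ such that each $\pi_j(\widetilde V_j)$ is open in $Y$ and $\bigcup_j\pi_j(\widetilde V_j)=Y$. **Statement.** Let $K$ be a discrete group acting smoothly, properly and effectively on an $n$-dimensional manifold $M$, let $L\subset K$ be a subgroup and let $N\subset M$ be a $k$-dimensional $L$-submanifold such that the map $N/L\to M/K$, $Lp\mapsto Kp$, is a topological embedding. Then $M/K$ is an orbifold, and (the image of) $N/L$ is a $k$-dimensional suborbifold of $M/K$. Here the orbifold structure on $M/K$ is given by the maximal atlas determined by the charts $(W/K_p,\;W/\overline{K_p},\;q|_W)$ (and all charts isomorphic to one of these by a diffeomorphism and a group isomorphism compatible with the actions and projections), where $q\colon M\to M/K$ is the projection, $p\in M$, $W$ is a connected $K_p$-invariant open neighbourhood of $p$ such that $gW\cap W\neq\emptyset$ only for $g$ in the stabilizer $K_p$, $W/K_p$ is identified with the open set $q(W)\subset M/K$, and $\overline{K_p}$ is the image of $K_p$ in the diffeomorphism group of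 $W$ (that is, $K_p$ itself if $K_p$ acts effectively on $W$, which is automatic when $M$ is connected); that these charts form an orbifold atlas is part of the claim. -/

import Mathlib

open scoped Manifold ContDiff
open Topology

universe u v

/-- `N` is an (embedded) `k`-dimensional smooth submanifold of the `n`-dimensional smooth
manifold `M`: around each of its points there is a chart of `M` in which `N` is a
`k`-dimensional linear subspace. -/
def IsEmbeddedSubmanifold {n : ℕ} {M : Type u} [TopologicalSpace M]
    [ChartedSpace (EuclideanSpace ℝ (Fin n)) M] (k : ℕ) (N : Set M) : Prop :=
  ∀ p ∈ N, ∃ φ ∈ IsManifold.maximalAtlas (𝓡 n) ∞ M, p ∈ φ.source ∧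
    ∃ E : Submodule ℝ (EuclideanSpace ℝ (Fin n)), Module.finrank ℝ E = k ∧
      ∀ x ∈ φ.source, x ∈ N ↔ φ x ∈ E

/-- `N ⊆ M` is a `k`-dimensional `L`-submanifold of the `K`-manifold `M`: an `L`-invariant
submanifold such that points of `N` in the same `K`-orbit are in the same `L`-orbit. -/
structure IsLSubmanifold {n : ℕ} {M : Type u} [TopologicalSpace M]
    [ChartedSpace (EuclideanSpace ℝ (Fin n)) M] {K : Type v} [Group K] [MulAction K M]
    (k : ℕ) (L : Subgroup K) (N : Set M) : Prop where
  submanifold : IsEmbeddedSubmanifold (n := n) k N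
  invariant : ∀ l ∈ L, ∀ p ∈ N, l • p ∈ N
  exists_smul_eq : ∀ g : K, ∀ p ∈ N, g • p ∈ N → ∃ l ∈ L, l • p = g • p

/-- An `n`-dimensional orbifold chart `(U, Ũ / Γ, π)` on `X`; here `Ũ` is `carrier`, `Γ` is
`group`, `π` is `proj` and `U` is the range of `π`. -/
structure OrbifoldChart (n : ℕ) (X : Type u) [TopologicalSpace X] where
  carrier : Type u
  [topology : TopologicalSpace carrier]
  [charted : ChartedSpace (EuclideanSpace ℝ (Fin n)) carrier]
  [manifold : IsManifold (𝓡 n) ∞ carrier]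
  [t2 : T2Space carrier]
  [secondCountable : SecondCountableTopology carrier]
  [connected : ConnectedSpace carrier]
  group : Type u
  [groupStr : Group group]
  [finite : Finite group]
  [action : MulAction group carrier]
  [effective : FaithfulSMul group carrier]
  smooth_smul : ∀ γ : group, ContMDiff (𝓡 n) (𝓡 n) ∞ (fun x : carrier => γ • x)
  proj : carrier → X
  continuous_proj : Continuous proj
  proj_eq : ∀ x y : carrier, (MulAction.orbitRel group carrier) x y → proj x = proj y
  /-- `π` induces a homeomorphism of `Ũ / Γ` onto an open subset of `X`. -/
  isOpenEmbedding_lift :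
    IsOpenEmbedding (Quotient.lift (s := MulAction.orbitRel group carrier) proj proj_eq)

namespace OrbifoldChart

attribute [instance] topology charted manifold t2 secondCountable connected groupStr finite
  action effective

variable {n : ℕ} {X : Type u} [TopologicalSpace X]

/-- The open subset `U` of `X` covered by the chart. -/
def support (c : OrbifoldChart n X) : Set X := Set.range c.proj

/-- An injection of charts: a smooth embedding `λ : Ũ₁ → Ũ₂` with `π₂ ∘ λ = π₁`. -/
structure IsInjection (c₁ c₂ : OrbifoldChart n X) (f : c₁.carrier → c₂.carrier) : Prop where
  isSmoothEmbedding : Manifold.IsSmoothEmbedding (𝓡 n) (𝓡 n) ∞ f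
  proj_comp : c₂.proj ∘ f = c₁.proj

/-- Compatibility of charts. -/
def Compatible (c₁ c₂ : OrbifoldChart n X) : Prop :=
  ∀ x ∈ c₁.support ∩ c₂.support, ∃ w : OrbifoldChart n X,
    x ∈ w.support ∧ w.support ⊆ c₁.support ∩ c₂.support ∧
    (∃ f : w.carrier → c₁.carrier, IsInjection w c₁ f) ∧
    (∃ f : w.carrier → c₂.carrier, IsInjection w c₂ f)

end OrbifoldChart

/-- `𝒜` is an `n`-dimensional orbifold atlas on the second countable Hausdorff space `X`. -/
structure IsOrbifoldAtlas {n : ℕ} {X : Type u} [TopologicalSpace X]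
    (𝒜 : Set (OrbifoldChart n X)) : Prop where
  t2 : T2Space X
  secondCountable : SecondCountableTopology X
  compatible : ∀ c₁ ∈ 𝒜, ∀ c₂ ∈ 𝒜, c₁.Compatible c₂
  cover : ∀ x : X, ∃ c ∈ 𝒜, x ∈ c.support

/-- The maximal orbifold atlas determined by an orbifold atlas `𝒜`: all charts compatible with
every chart in `𝒜`. -/
def orbifoldMaximalAtlas {n : ℕ} {X : Type u} [TopologicalSpace X]
    (𝒜 : Set (OrbifoldChart n X)) : Set (OrbifoldChart n X) :=
  {c | ∀ d ∈ 𝒜, c.Compatible d}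

/-- A `k`-dimensional suborbifold cover on `Y ⊆ X` with respect to `𝒜`: a family of charts
`(U_j, Ũ_j / Γ_j, π_j)` of `𝒜`, with connected `k`-dimensional submanifolds `Ṽ_j ⊆ Ũ_j` which
are `Δ_j`-submanifolds for some subgroups `Δ_j ≤ Γ_j`, such that the sets `π_j (Ṽ_j)` are open
in `Y` and cover `Y`. -/
structure SuborbifoldCover {n : ℕ} {X : Type u} [TopologicalSpace X]
    (𝒜 : Set (OrbifoldChart n X)) (k : ℕ) (Y : Set X) where
  ι : Type u
  chart : ι → OrbifoldChart n X
  chart_mem : ∀ j, chart j ∈ 𝒜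
  V : (j : ι) → Set (chart j).carrier
  isConnected : ∀ j, IsConnected (V j)
  isLSubmanifold : ∀ j, ∃ Δ : Subgroup (chart j).group, IsLSubmanifold (n := n) k Δ (V j)
  isOpen_image : ∀ j, ∃ O : Set X, IsOpen O ∧ (chart j).proj '' V j = O ∩ Y
  iUnion_image : ⋃ j, (chart j).proj '' V j = Y

/-- `Y` is a `k`-dimensional suborbifold of `X` equipped with the orbifold atlas `𝒜`. -/
def IsSuborbifold {n : ℕ} {X : Type u} [TopologicalSpace X]
    (𝒜 : Set (OrbifoldChart n X)) (k : ℕ) (Y : Set X) : Prop :=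
  Nonempty (SuborbifoldCover 𝒜 k Y)

section Quotient

variable (K : Type v) [Group K] (M : Type u) [TopologicalSpace M] [MulAction K M]

/-- The quotient space `M / K`, with the quotient topology. -/
abbrev OrbitSpace : Type u := Quotient (MulAction.orbitRel K M)

variable {K M}

/-- The relation `p ∈ L • q` on a subset `N` of `M`; the quotient of `N` by it is `N / L`. -/
def subOrbitRel (L : Subgroup K) (N : Set M) : Setoid N :=
  (MulAction.orbitRel L M).comap Subtype.val

/-- The space `N / L`, with the quotient topology of the subspace topology of `N`. -/
abbrev SubOrbitSpace (L : Subgroup K) (N : Set M) : Type u := Quotient (subOrbitRel L N)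

/-- The canonical map `N / L → M / K`, `L p ↦ K p`. -/
def subOrbitSpaceMap (L : Subgroup K) (N : Set M) : SubOrbitSpace L N → OrbitSpace K M :=
  Quotient.lift (fun p : N => (Quotient.mk (MulAction.orbitRel K M) (p : M)))
    (by
      rintro a b ⟨l, hl⟩
      exact Quotient.sound ⟨(l : K), hl⟩)

variable {n : ℕ} [ChartedSpace (EuclideanSpace ℝ (Fin n)) M]

/-- The standard charts `(π(W), W / K_p, π)` of `M / K`. Here `W` is a connected open
neighbourhood of a point `p`, invariant under the stabilizer `K_p`, such that `g W` meets `W`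
only for `g ∈ K_p`. The acting group is the image of `K_p` in the diffeomorphism group of `W`
(so it is `K_p` itself when `K_p` acts effectively on `W`, as is automatic for an effective
proper action on a connected `M`). The chart domain `Ũ` and the group `Γ` are identified with
`W` and that image by a diffeomorphism `φ` and a surjection `ψ`. -/
def IsQuotientChart (c : OrbifoldChart n (OrbitSpace K M)) : Prop :=
  ∃ (p : M) (W : TopologicalSpace.Opens M) (φ : c.carrier ≃ₘ^∞⟮𝓡 n, 𝓡 n⟯ W)
    (ψ : MulAction.stabilizer K p →* c.group),
    p ∈ W ∧ IsConnected (W : Set M) ∧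
    (∀ g : MulAction.stabilizer K p, ∀ q ∈ W, g • q ∈ W) ∧
    (∀ g : K, (∃ q ∈ W, g • q ∈ W) → g ∈ MulAction.stabilizer K p) ∧
    Function.Surjective ψ ∧
    (∀ (g : MulAction.stabilizer K p) (x : c.carrier), (φ (ψ g • x) : M) = g • (φ x : M)) ∧
    (∀ x : c.carrier, c.proj x = Quotient.mk (MulAction.orbitRel K M) (φ x : M))

variable (K M n)

/-- The set of all standard charts of `M / K`. -/
def quotientCharts : Set (OrbifoldChart n (OrbitSpace K M)) := {c | IsQuotientChart c}

/-- The canonical (maximal) orbifold atlas of `M / K`. -/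
def quotientOrbifoldAtlas : Set (OrbifoldChart n (OrbitSpace K M)) :=
  orbifoldMaximalAtlas (quotientCharts K M n)

end Quotient

/-! Properness gives every point `p` a slice `W`, and `W` modulo the finite group induced by `K_p`
is an open piece of `M / K`. If two standard charts meet at an orbit containing `a` and `g • a`, a
slice at `a` inside `W₁ ∩ g⁻¹ W₂` maps to both, by inclusion and by translation by `g`; hence the
charts are compatible.

For `p ∈ N`, let `V` be the component of `N ∩ W` at `p`. It is open in `N` since submanifolds are
locally connected, and `L ∩ K_p` preserves it since `p` is fixed. If `x` and `g • x` lie in `V`,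
some `l ∈ L` satisfies `l • x = g • x`; both points lie in `W`, so `l ∈ K_p`. This is
`IsLSubmanifold.connectedComponentIn_slice`. Finally `N → N / L` is open, and the embedding
hypothesis turns open subsets of `N / L` into relatively open subsets of its image
(`exists_isOpen_image_eq_inter_range`). -/

open Set

/-! ### Open embeddings with smooth inverse. -/

section SmoothEmbedding

variable {𝕜 : Type*} [NontriviallyNormedField 𝕜] {E : Type*} [NormedAddCommGroup E]
  [NormedSpace 𝕜 E] {H : Type*} [TopologicalSpace H] {I : ModelWithCorners 𝕜 E H} {m : ℕ∞ω}
  {A B : Type*} [TopologicalSpace A] [ChartedSpace H A] [IsManifold I m A]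
  [TopologicalSpace B] [ChartedSpace H B] [IsManifold I m B]

omit [IsManifold I m B] in
/-- The composition of a smooth open embedding whose inverse is smooth with a chart of the target
is a chart of the source. -/
theorem OpenPartialHomeomorph.trans_mem_maximalAtlas (F : OpenPartialHomeomorph A B)
    (hF : ContMDiffOn I I m F F.source) (hF' : ContMDiffOn I I m F.symm F.target)
    {e : OpenPartialHomeomorph B H} (he : e ∈ IsManifold.maximalAtlas I m B) :
    F.trans e ∈ IsManifold.maximalAtlas I m A := by
  apply OpenPartialHomeomorph.mem_maximalAtlas_of_contMDiffOn
  · rw [OpenPartialHomeomorph.coe_trans]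
    refine (contMDiffOn_of_mem_maximalAtlas he).comp (hF.mono ?_) ?_
    · rw [F.trans_source]; exact inter_subset_left
    · rw [F.trans_source]; exact inter_subset_right
  · rw [F.coe_trans_symm, F.trans_target]
    exact hF'.comp ((contMDiffOn_symm_of_mem_maximalAtlas he).mono inter_subset_left)
      inter_subset_right

/-- A smooth open partial homeomorphism defined everywhere, with smooth inverse, is a smooth
embedding. -/
theorem OpenPartialHomeomorph.isSmoothEmbedding (F : OpenPartialHomeomorph A B)
    (hs : F.source = univ)
    (hF : ContMDiff I I m F) (hF' : ContMDiffOn I I m F.symm F.target) :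
    Manifold.IsSmoothEmbedding I I m F := by
  refine ⟨?_, (F.isOpenEmbedding hs).isEmbedding⟩
  -- The complement is trivial: in a chart of the target and its pullback along `F`, the map `F`
  -- becomes the identity.
  have : Manifold.IsImmersionOfComplement PUnit I I m F := by
    intro x
    have hc : chartAt H (F x) ∈ IsManifold.maximalAtlas I m B :=
      IsManifold.chart_mem_maximalAtlas _
    refine .mk_of_continuousAt hF.continuous.continuousAt (.prodUnique 𝕜 E PUnit)
      (F.trans (chartAt H (F x))) (chartAt H (F x)) ?_ (mem_chart_source _ _)
      (F.trans_mem_maximalAtlas hF.contMDiffOn hF' hc) hc ?_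
    · simp [hs]
    · intro y hy
      have hy' := ((F.trans (chartAt H (F x))).extend I).right_inv hy
      simpa using hy'
  exact this.isImmersion

end SmoothEmbedding

/-! ### Slices, their orbifold charts and compatibility. -/

section Slice

variable {n : ℕ} {M : Type u} [TopologicalSpace M]
  [ChartedSpace (EuclideanSpace ℝ (Fin n)) M] {K : Type v} [Group K] [MulAction K M]

/-- `W` is a slice at `p`: a connected open `K_p`-invariant neighbourhood of `p` whose translates
by elements outside of `K_p` are disjoint from it. -/
structure IsSlice (K : Type v) [Group K] [MulAction K M] (p : M)
    (W : TopologicalSpace.Opens M) : Prop where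
  mem : p ∈ W
  isConnected : IsConnected (W : Set M)
  smul_mem : ∀ g : MulAction.stabilizer K p, ∀ q ∈ W, g • q ∈ W
  mem_stabilizer : ∀ g : K, (∃ q ∈ W, g • q ∈ W) → g ∈ MulAction.stabilizer K p

omit [ChartedSpace (EuclideanSpace ℝ (Fin n)) M] in
/-- Every neighbourhood of a point contains a slice. -/
theorem exists_isSlice [T2Space M] [LocallyCompactSpace M] [LocallyConnectedSpace M]
    [ContinuousConstSMul K M] [ProperlyDiscontinuousSMul K M] (p : M) {U : Set M}
    (hU : U ∈ 𝓝 p) : ∃ W : TopologicalSpace.Opens M, IsSlice K p W ∧ (W : Set M) ⊆ U := by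
  obtain ⟨U', hU', hU'K⟩ := ProperlyDiscontinuousSMul.exists_nhds_image_smul_eq_self K p
  obtain ⟨O, hOU, hO, hpO⟩ := mem_nhds_iff.1 (Filter.inter_mem hU hU')
  have hfin : Finite (MulAction.stabilizer K p) :=
    (ProperlyDiscontinuousSMul.finite_stabilizer (Γ := K) p).to_subtype
  -- Intersecting over the finite stabilizer makes `O` invariant while keeping it open.
  let A : Set M := ⋂ g : MulAction.stabilizer K p, (fun x => g • x) ⁻¹' O
  have hA : IsOpen A := isOpen_iInter_of_finite fun g => hO.preimage (continuous_const_smul (g : K))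
  have hpA : p ∈ A := mem_iInter.2 fun g => by
    have : g • p = p := g.2
    simpa [this] using hpO
  have hAO : A ⊆ O := fun x hx => by simpa using mem_iInter.1 hx 1
  have hAs : ∀ g : MulAction.stabilizer K p, ∀ q ∈ A, g • q ∈ A := fun g q hq =>
    mem_iInter.2 fun h => by simpa [smul_smul] using mem_iInter.1 hq (h * g)
  refine ⟨⟨connectedComponentIn A p, hA.connectedComponentIn⟩, ⟨mem_connectedComponentIn hpA,
    isConnected_connectedComponentIn_iff.2 hpA, fun g q hq => ?_, fun g hg => ?_⟩, ?_⟩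
  -- The translated component is connected, lies in `A` and still contains the fixed point `p`.
  · have hsub : (fun x => g • x) '' connectedComponentIn A p ⊆ connectedComponentIn A p := by
      refine (isPreconnected_connectedComponentIn.image _
        (continuous_const_smul (g : K)).continuousOn).subset_connectedComponentIn
        ⟨p, mem_connectedComponentIn hpA, g.2⟩ ?_
      rintro _ ⟨x, hx, rfl⟩
      exact hAs g x (connectedComponentIn_subset _ _ hx)
    exact hsub ⟨q, hq, rfl⟩
  · obtain ⟨q, hq, hgq⟩ := hg
    exact hU'K g ⟨g • q, ⟨q, (hOU (hAO (connectedComponentIn_subset _ _ hq))).2, rfl⟩,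
      (hOU (hAO (connectedComponentIn_subset _ _ hgq))).2⟩
  · exact fun x hx => (hOU (hAO (connectedComponentIn_subset _ _ hx))).1

/-- The action of the stabilizer of `p` on an invariant open set. -/
def stabilizerToPerm {p : M} {W : TopologicalSpace.Opens M}
    (hW : ∀ g : MulAction.stabilizer K p, ∀ q ∈ W, g • q ∈ W) :
    MulAction.stabilizer K p →* Equiv.Perm W :=
  letI : MulAction (MulAction.stabilizer K p) W :=
    { smul := fun g x => ⟨g • (x : M), hW g x x.2⟩
      one_smul := fun x => Subtype.ext (one_smul K (x : M))
      mul_smul := fun g h x => Subtype.ext (mul_smul (g : K) (h : K) (x : M)) }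
  MulAction.toPermHom _ W

omit [ChartedSpace (EuclideanSpace ℝ (Fin n)) M] in
@[simp]
theorem coe_stabilizerToPerm {p : M} {W : TopologicalSpace.Opens M}
    (hW : ∀ g : MulAction.stabilizer K p, ∀ q ∈ W, g • q ∈ W) (g : MulAction.stabilizer K p)
    (x : W) : (stabilizerToPerm hW g x : M) = (g : K) • (x : M) := rfl

variable [T2Space M] [SecondCountableTopology M] [IsManifold (𝓡 n) ∞ M]

/-- The orbifold chart of `M / K` given by a slice. -/
noncomputable def sliceChart [ContinuousConstSMul K M]
    (hK : ∀ g : K, ContMDiff (𝓡 n) (𝓡 n) ∞ (fun p : M => g • p)) {p : M}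
    [Finite (MulAction.stabilizer K p)] {W : TopologicalSpace.Opens M} (hW : IsSlice K p W) :
    OrbifoldChart n (OrbitSpace K M) :=
  haveI : ConnectedSpace W := isConnected_iff_connectedSpace.1 hW.isConnected
  { carrier := W
    group := (stabilizerToPerm hW.smul_mem).range
    finite := Finite.of_surjective _ (stabilizerToPerm hW.smul_mem).rangeRestrict_surjective
    smooth_smul := by
      rintro ⟨_, g, rfl⟩
      exact (ContMDiff.subtypeVal_comp_iff W _).1 ((hK g).comp contMDiff_subtype_val)
    proj := fun x => Quotient.mk (MulAction.orbitRel K M) (x : M)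
    continuous_proj := continuous_quot_mk.comp continuous_subtype_val
    proj_eq := by
      rintro _ y ⟨⟨_, g, rfl⟩, rfl⟩
      exact Quotient.sound ⟨(g : K), rfl⟩
    isOpenEmbedding_lift := by
      refine .of_continuous_injective_isOpenMap
        (continuous_quot_lift _ (continuous_quot_mk.comp continuous_subtype_val)) ?_ ?_
      -- An element of `K` relating two points of `W` lies in `K_p` by the slice property.
      · rintro ⟨x⟩ ⟨y⟩ h
        obtain ⟨g, hg⟩ := Quotient.exact (s := MulAction.orbitRel K M) h
        have hg : g • (y : M) = x := hg
        have hgp := hW.mem_stabilizer g ⟨y, y.2, hg ▸ x.2⟩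
        exact Quotient.sound ⟨⟨_, ⟨g, hgp⟩, rfl⟩, Subtype.ext hg⟩
      · intro O hO
        have := (MulAction.isOpenQuotientMap_quotientMk (Γ := K) (T := M)).isOpenMap _
          (W.isOpen.isOpenMap_subtype_val _ (hO.preimage continuous_quot_mk))
        convert this using 1
        ext z
        constructor
        · rintro ⟨⟨x⟩, hx, rfl⟩
          exact ⟨x, ⟨x, hx, rfl⟩, rfl⟩
        · rintro ⟨_, ⟨x, hx, rfl⟩, rfl⟩
          exact ⟨_, hx, rfl⟩ }

theorem sliceChart_mem_quotientCharts [ContinuousConstSMul K M]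
    (hK : ∀ g : K, ContMDiff (𝓡 n) (𝓡 n) ∞ (fun p : M => g • p)) {p : M}
    [Finite (MulAction.stabilizer K p)] {W : TopologicalSpace.Opens M} (hW : IsSlice K p W) :
    sliceChart hK hW ∈ quotientCharts K M n :=
  ⟨p, W, Diffeomorph.refl _ _ _, (stabilizerToPerm hW.smul_mem).rangeRestrict, hW.mem,
    hW.isConnected, hW.smul_mem, hW.mem_stabilizer,
    (stabilizerToPerm hW.smul_mem).rangeRestrict_surjective, fun _ _ => rfl, fun _ => rfl⟩

omit [T2Space M] [SecondCountableTopology M] in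
/-- Translation by `g` from an open set `W` into an open set `W'` diffeomorphic to `C` gives a smooth
embedding of `W` into `C`. -/
theorem exists_isSmoothEmbedding_comp_eq [ContinuousConstSMul K M]
    (hK : ∀ g : K, ContMDiff (𝓡 n) (𝓡 n) ∞ (fun p : M => g • p)) (g : K)
    {C : Type u} [TopologicalSpace C] [ChartedSpace (EuclideanSpace ℝ (Fin n)) C]
    [IsManifold (𝓡 n) ∞ C] {W W' : TopologicalSpace.Opens M} [Nonempty W]
    (φ : C ≃ₘ^∞⟮𝓡 n, 𝓡 n⟯ W') (hWW : ∀ x ∈ W, g • x ∈ W') :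
    ∃ f : W → C, Manifold.IsSmoothEmbedding (𝓡 n) (𝓡 n) ∞ f ∧
      ∀ x, (φ (f x) : M) = g • (x : M) := by
  let f : W → C := fun x => φ.symm ⟨g • (x : M), hWW x x.2⟩
  have hφf : ∀ x, (φ (f x) : M) = g • (x : M) := fun x => by simp [f]
  have hfs : ContMDiff (𝓡 n) (𝓡 n) ∞ f :=
    φ.symm.contMDiff.comp
      ((ContMDiff.subtypeVal_comp_iff W' _).1 ((hK g).comp contMDiff_subtype_val))
  have hinj : Function.Injective f := fun x y h => by
    have := hφf x
    rw [h, hφf y] at this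
    exact Subtype.ext (smul_left_cancel g this.symm)
  have hopen : IsOpenMap f := fun O hO => by
    have hO' := ((isOpenMap_smul g) _ (W.isOpen.isOpenMap_subtype_val _ hO)).preimage
      (continuous_subtype_val.comp φ.continuous)
    convert hO' using 1
    ext c
    constructor
    · rintro ⟨x, hx, rfl⟩
      exact ⟨x, ⟨x, hx, rfl⟩, (hφf x).symm⟩
    · rintro ⟨_, ⟨x, hx, rfl⟩, hc⟩
      exact ⟨x, hx, φ.injective (Subtype.ext ((hφf x).trans hc))⟩
  have hemb : IsOpenEmbedding f := .of_continuous_injective_isOpenMap hfs.continuous hinj hopen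
  refine ⟨f, (hemb.toOpenPartialHomeomorph f).isSmoothEmbedding rfl hfs ?_, hφf⟩
  -- Viewed in `M`, the inverse is `c ↦ g⁻¹ • φ c` on the image of `f`.
  intro c hc
  refine ContMDiffAt.contMDiffWithinAt ?_
  rw [← ContMDiffAt.subtypeVal_comp_iff]
  have hsm : ContMDiff (𝓡 n) (𝓡 n) ∞ (fun c : C => g⁻¹ • (φ c : M)) :=
    (hK g⁻¹).comp (contMDiff_subtype_val.comp φ.contMDiff)
  refine hsm.contMDiffAt.congr_of_eventuallyEq ?_
  filter_upwards [(hemb.toOpenPartialHomeomorph f).open_target.mem_nhds hc] with d hd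
  have hd' : f ((hemb.toOpenPartialHomeomorph f).symm d) = d :=
    (hemb.toOpenPartialHomeomorph f).right_inv hd
  rw [Function.comp_apply, eq_inv_smul_iff, ← hφf, hd']

/-- Any two standard charts of `M / K` are compatible. -/
theorem quotientCharts_compatible [LocallyCompactSpace M] [LocallyConnectedSpace M]
    [ContinuousConstSMul K M] [ProperlyDiscontinuousSMul K M]
    (hK : ∀ g : K, ContMDiff (𝓡 n) (𝓡 n) ∞ (fun p : M => g • p))
    {c₁ c₂ : OrbifoldChart n (OrbitSpace K M)} (h₁ : c₁ ∈ quotientCharts K M n)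
    (h₂ : c₂ ∈ quotientCharts K M n) : c₁.Compatible c₂ := by
  obtain ⟨p₁, W₁, φ₁, ψ₁, -, -, -, -, -, -, hπ₁⟩ := h₁
  obtain ⟨p₂, W₂, φ₂, ψ₂, -, -, -, -, -, -, hπ₂⟩ := h₂
  rintro _ ⟨⟨a, rfl⟩, ⟨b, hb⟩⟩
  rw [hπ₁, hπ₂] at hb
  obtain ⟨g, hg⟩ := Quotient.exact (s := MulAction.orbitRel K M) hb
  have hg : g • (φ₁ a : M) = φ₂ b := hg
  have hnhds : (W₁ : Set M) ∩ (fun x => g • x) ⁻¹' (W₂ : Set M) ∈ 𝓝 (φ₁ a : M) :=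
    Filter.inter_mem (W₁.isOpen.mem_nhds (φ₁ a).2)
      ((W₂.isOpen.preimage (continuous_const_smul g)).mem_nhds (by
        rw [mem_preimage, hg]; exact (φ₂ b).2))
  obtain ⟨W, hW, hWs⟩ := exists_isSlice (K := K) (φ₁ a : M) hnhds
  have hfin : Finite (MulAction.stabilizer K (φ₁ a : M)) :=
    (ProperlyDiscontinuousSMul.finite_stabilizer (Γ := K) (φ₁ a : M)).to_subtype
  have : Nonempty W := ⟨⟨_, hW.mem⟩⟩
  obtain ⟨f₁, hf₁, hφf₁⟩ := exists_isSmoothEmbedding_comp_eq hK 1 φ₁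
    (W := W) (fun x hx => by simpa using (hWs hx).1)
  obtain ⟨f₂, hf₂, hφf₂⟩ := exists_isSmoothEmbedding_comp_eq hK g φ₂
    (W := W) (fun x hx => (hWs hx).2)
  have e₁ : c₁.proj ∘ f₁ = (sliceChart hK hW).proj := funext fun x => by
    rw [Function.comp_apply, hπ₁, hφf₁, one_smul]; rfl
  have e₂ : c₂.proj ∘ f₂ = (sliceChart hK hW).proj := funext fun x => by
    rw [Function.comp_apply, hπ₂, hφf₂]
    exact Quotient.sound ⟨g, rfl⟩
  refine ⟨sliceChart hK hW, ⟨⟨_, hW.mem⟩, (hπ₁ a).symm⟩, ?_, ⟨f₁, hf₁, e₁⟩, ⟨f₂, hf₂, e₂⟩⟩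
  rintro _ ⟨x, rfl⟩
  exact ⟨⟨f₁ x, congrFun e₁ x⟩, ⟨f₂ x, congrFun e₂ x⟩⟩

end Slice

/-! ### Local connectedness and restriction of submanifolds. -/

section Submanifold

variable {n k : ℕ} {M : Type u} [TopologicalSpace M]
  [ChartedSpace (EuclideanSpace ℝ (Fin n)) M]

/-- Submanifolds are locally connected. -/
theorem IsEmbeddedSubmanifold.exists_isPreconnected {N : Set M}
    (hN : IsEmbeddedSubmanifold (n := n) k N) {p : M} (hp : p ∈ N) {U : Set M} (hU : IsOpen U)
    (hpU : p ∈ U) :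
    ∃ C ⊆ N ∩ U, IsPreconnected C ∧ ∃ O, IsOpen O ∧ p ∈ O ∧ N ∩ O ⊆ C := by
  obtain ⟨φ, -, hpφ, E, -, hE⟩ := hN p hp
  have hopen : IsOpen (φ.target ∩ φ.symm ⁻¹' U) := φ.isOpen_inter_preimage_symm hU
  obtain ⟨ε, hε, hball⟩ := Metric.isOpen_iff.1 hopen (φ p)
    ⟨φ.map_source hpφ, by rwa [mem_preimage, φ.left_inv hpφ]⟩
  refine ⟨φ.symm '' (Metric.ball (φ p) ε ∩ E), ?_, ?_, φ.source ∩ φ ⁻¹' Metric.ball (φ p) ε,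
    φ.isOpen_inter_preimage Metric.isOpen_ball, ⟨hpφ, Metric.mem_ball_self hε⟩, ?_⟩
  · rintro _ ⟨y, ⟨hy, hyE⟩, rfl⟩
    refine ⟨(hE _ (φ.map_target (hball hy).1)).2 ?_, (hball hy).2⟩
    rwa [φ.right_inv (hball hy).1]
  -- A ball intersected with a linear subspace is convex.
  · exact ((convex_ball _ _).inter E.convex).isPreconnected.image _
      (φ.continuousOn_symm.mono fun y hy => (hball hy.1).1)
  · rintro x ⟨hxN, hx, hxb⟩
    exact ⟨φ x, ⟨hxb, (hE x hx).1 hxN⟩, φ.left_inv hx⟩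

/-- Connected components of a submanifold intersected with an open set are relatively open. -/
theorem IsEmbeddedSubmanifold.exists_isOpen_connectedComponentIn {N : Set M}
    (hN : IsEmbeddedSubmanifold (n := n) k N) {U : Set M} (hU : IsOpen U) (p : M) :
    ∃ O, IsOpen O ∧ connectedComponentIn (N ∩ U) p = N ∩ O := by
  refine ⟨⋃₀ {O | IsOpen O ∧ N ∩ O ⊆ connectedComponentIn (N ∩ U) p},
    isOpen_sUnion fun O hO => hO.1, Subset.antisymm (fun x hx => ?_) ?_⟩
  · have hxNU := connectedComponentIn_subset _ _ hx
    obtain ⟨C, hCsub, hC, O, hO, hxO, hOC⟩ := hN.exists_isPreconnected hxNU.1 hU hxNU.2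
    refine ⟨hxNU.1, O, ⟨hO, hOC.trans ?_⟩, hxO⟩
    rw [connectedComponentIn_eq hx]
    exact hC.subset_connectedComponentIn (hOC ⟨hxNU.1, hxO⟩) hCsub
  · rintro x ⟨hxN, O, hO, hxO⟩
    exact hO.2 ⟨hxN, hxO⟩

/-- A relatively open subset of a submanifold is a submanifold of any open set containing it. -/
theorem IsEmbeddedSubmanifold.preimage_val [IsManifold (𝓡 n) ∞ M] {N : Set M}
    (hN : IsEmbeddedSubmanifold (n := n) k N) (W : TopologicalSpace.Opens M) {O : Set M}
    (hO : IsOpen O) :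
    IsEmbeddedSubmanifold (n := n) k ((↑) ⁻¹' (N ∩ O) : Set W) := by
  rintro p ⟨hpN, hpO⟩
  have : Nonempty W := ⟨p⟩
  obtain ⟨φ, hφ, hpφ, E, hk, hE⟩ := hN p hpN
  let F : OpenPartialHomeomorph W M := (W.openPartialHomeomorphSubtypeCoe ‹_›)
  have hFφ : F.trans φ ∈ IsManifold.maximalAtlas (𝓡 n) ∞ W := by
    refine F.trans_mem_maximalAtlas contMDiff_subtype_val.contMDiffOn ?_ hφ
    intro x hx
    refine ContMDiffAt.contMDiffWithinAt ?_
    rw [← ContMDiffAt.subtypeVal_comp_iff]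
    refine contMDiffAt_id.congr_of_eventuallyEq ?_
    filter_upwards [F.open_target.mem_nhds hx] with d hd
    exact F.right_inv hd
  refine ⟨(F.trans φ).restr ((↑) ⁻¹' O),
    restr_mem_maximalAtlas _ hFφ (hO.preimage continuous_subtype_val), ?_, E, hk, ?_⟩
  · rw [OpenPartialHomeomorph.restr_source' _ _ (hO.preimage continuous_subtype_val)]
    exact ⟨by simpa [F] using hpφ, hpO⟩
  · intro x hx
    rw [OpenPartialHomeomorph.restr_source' _ _ (hO.preimage continuous_subtype_val)] at hx
    have hxφ : (x : M) ∈ φ.source := by simpa [F] using hx.1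
    exact ⟨fun h => (hE x hxφ).1 h.1, fun h => ⟨(hE x hxφ).2 h, hx.2⟩⟩

end Submanifold

/-! ### From `L`-submanifolds to suborbifold charts. -/

section Suborbifold

variable {n k : ℕ} {M : Type u} [TopologicalSpace M]
  {K : Type v} [Group K] [MulAction K M]

/-- The image in `M / K` of a relatively open subset of `N` is open in the image of `N / L`. -/
theorem exists_isOpen_image_eq_inter_range [ContinuousConstSMul K M] {L : Subgroup K} {N : Set M}
    (hL : ∀ l ∈ L, ∀ p ∈ N, l • p ∈ N) (hemb : IsEmbedding (subOrbitSpaceMap L N)) {O : Set M}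
    (hO : IsOpen O) :
    ∃ O' : Set (OrbitSpace K M), IsOpen O' ∧
      Quotient.mk (MulAction.orbitRel K M) '' (N ∩ O) = O' ∩ range (subOrbitSpaceMap L N) := by
  let T : Set (SubOrbitSpace L N) := Quotient.mk (subOrbitRel L N) '' ((↑) ⁻¹' O)
  have hT : IsOpen T := by
    -- The `L`-saturation of an open set is a union of its translates, so `N → N / L` is open.
    have : Quotient.mk (subOrbitRel L N) ⁻¹' T = ⋃ l : L, {x : N | (l : K) • (x : M) ∈ O} := by
      ext x
      simp only [mem_preimage, mem_iUnion, mem_ofPred_eq]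
      constructor
      · rintro ⟨y, hy, hxy⟩
        obtain ⟨l, hl⟩ := Quotient.exact hxy
        exact ⟨l, (show (l : K) • (x : M) = y from hl) ▸ hy⟩
      · rintro ⟨l, hl⟩
        exact ⟨⟨(l : K) • (x : M), hL l l.2 x x.2⟩, hl, Quotient.sound ⟨l, rfl⟩⟩
    rw [← isQuotientMap_quotient_mk'.isOpen_preimage]
    change IsOpen (Quotient.mk (subOrbitRel L N) ⁻¹' T)
    rw [this]
    exact isOpen_iUnion fun l =>
      hO.preimage ((continuous_const_smul (l : K)).comp continuous_subtype_val)
  obtain ⟨O', hO', hOT⟩ := hemb.isInducing.isOpen_iff.1 hT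
  refine ⟨O', hO', ?_⟩
  rw [← image_preimage_eq_inter_range, hOT]
  ext z
  constructor
  · rintro ⟨x, ⟨hxN, hxO⟩, rfl⟩
    exact ⟨_, ⟨⟨x, hxN⟩, hxO, rfl⟩, rfl⟩
  · rintro ⟨_, ⟨x, hx, rfl⟩, rfl⟩
    exact ⟨x, ⟨x.2, hx⟩, rfl⟩

/-- The connected component at `p` of an `L`-submanifold inside a slice at `p` is a
`Δ`-submanifold, where `Δ` is the group induced by the stabilizer of `p` in `L`. -/
theorem IsLSubmanifold.connectedComponentIn_slice
    [ChartedSpace (EuclideanSpace ℝ (Fin n)) M] [IsManifold (𝓡 n) ∞ M]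
    [T2Space M] [SecondCountableTopology M] [ContinuousConstSMul K M]
    (hK : ∀ g : K, ContMDiff (𝓡 n) (𝓡 n) ∞ (fun p : M => g • p))
    {L : Subgroup K} {N : Set M} (hN : IsLSubmanifold (n := n) k L N) {p : M} (hp : p ∈ N)
    [Finite (MulAction.stabilizer K p)] {W : TopologicalSpace.Opens M} (hW : IsSlice K p W) :
    ∃ Δ : Subgroup (sliceChart hK hW).group, IsLSubmanifold (n := n) k Δ
      (show Set (sliceChart hK hW).carrier from
        ((↑) ⁻¹' connectedComponentIn (N ∩ W) p : Set W)) := by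
  obtain ⟨O, hO, hOV⟩ := hN.submanifold.exists_isOpen_connectedComponentIn W.isOpen p
  -- `Δ` is the image of `L ∩ K_p` in the diffeomorphisms of `W`.
  refine ⟨(L.subgroupOf (MulAction.stabilizer K p)).map
    (stabilizerToPerm hW.smul_mem).rangeRestrict, ?_, ?_, ?_⟩
  · have := hN.submanifold.preimage_val W hO
    rw [← hOV] at this
    exact this
  · rintro _ ⟨g, hg, rfl⟩ q hq
    have hsub : (fun x => (g : K) • x) '' connectedComponentIn (N ∩ W) p ⊆
        connectedComponentIn (N ∩ W) p := by
      refine (isPreconnected_connectedComponentIn.image _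
        (continuous_const_smul (g : K)).continuousOn).subset_connectedComponentIn
        ⟨p, mem_connectedComponentIn ⟨hp, hW.mem⟩, g.2⟩ ?_
      rintro _ ⟨x, hx, rfl⟩
      have hx' := connectedComponentIn_subset _ _ hx
      exact ⟨hN.invariant _ hg _ hx'.1, hW.smul_mem g x hx'.2⟩
    exact hsub ⟨_, hq, rfl⟩
  · rintro ⟨_, g, rfl⟩ q hq hgq
    have hq' := connectedComponentIn_subset _ _ hq
    have hgq' := connectedComponentIn_subset _ _ hgq
    obtain ⟨l, hl, hlq⟩ := hN.exists_smul_eq (g : K) _ hq'.1 hgq'.1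
    have hlp := hW.mem_stabilizer l ⟨_, hq'.2, hlq ▸ hgq'.2⟩
    exact ⟨_, ⟨⟨l, hlp⟩, hl, rfl⟩, Subtype.ext hlq⟩

end Suborbifold

theorem mainTheorem7 {n k : ℕ}
    (M : Type u) [TopologicalSpace M] [T2Space M] [SecondCountableTopology M]
    [ChartedSpace (EuclideanSpace ℝ (Fin n)) M] [IsManifold (𝓡 n) ∞ M]
    (K : Type v) [Group K] [TopologicalSpace K] [DiscreteTopology K]
    [MulAction K M] [ProperSMul K M] [FaithfulSMul K M]
    (smooth_action : ∀ g : K, ContMDiff (𝓡 n) (𝓡 n) ∞ (fun p : M => g • p))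
    (L : Subgroup K) (N : Set M) (hN : IsLSubmanifold (n := n) k L N)
    (hemb : IsEmbedding (subOrbitSpaceMap L N)) :
    IsOrbifoldAtlas (quotientCharts K M n) ∧
      IsSuborbifold (quotientOrbifoldAtlas K M n) k (Set.range (subOrbitSpaceMap L N)) := by
  have : LocallyCompactSpace M := ChartedSpace.locallyCompactSpace (EuclideanSpace ℝ (Fin n)) M
  have : LocallyConnectedSpace M := ChartedSpace.locallyConnectedSpace (EuclideanSpace ℝ (Fin n)) M
  have : ProperlyDiscontinuousSMul K M := properlyDiscontinuousSMul_iff_properSMul.2 ‹_›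
  have hfin (p : M) : Finite (MulAction.stabilizer K p) :=
    (ProperlyDiscontinuousSMul.finite_stabilizer (Γ := K) p).to_subtype
  choose W hW _ using fun p : M => exists_isSlice (K := K) p Filter.univ_mem
  refine ⟨⟨inferInstance, ContinuousConstSMul.secondCountableTopology,
    fun c₁ h₁ c₂ h₂ => quotientCharts_compatible smooth_action h₁ h₂, ?_⟩, ⟨?_⟩⟩
  · rintro ⟨p⟩
    exact ⟨_, sliceChart_mem_quotientCharts smooth_action (hW p), ⟨p, (hW p).mem⟩, rfl⟩
  · have himage (p : N) : (fun x : W p => Quotient.mk (MulAction.orbitRel K M) (x : M)) ''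
        ((↑) ⁻¹' connectedComponentIn (N ∩ W p) p) =
        Quotient.mk (MulAction.orbitRel K M) '' connectedComponentIn (N ∩ W p) p := by
      rw [← image_image (Quotient.mk (MulAction.orbitRel K M)) Subtype.val,
        image_preimage_eq_of_subset]
      exact fun x hx => ⟨⟨x, (connectedComponentIn_subset _ _ hx).2⟩, rfl⟩
    exact
    { ι := N
      chart := fun p => sliceChart smooth_action (hW p)
      -- Pairwise compatibility puts standard charts in the maximal atlas.
      chart_mem := fun p c hc => quotientCharts_compatible smooth_action
        (sliceChart_mem_quotientCharts smooth_action (hW p)) hc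
      V := fun p => ((↑) ⁻¹' connectedComponentIn (N ∩ W p) p : Set (W p))
      isConnected := fun p => by
        have hp : (p : M) ∈ N ∩ W p := ⟨p.2, (hW p).mem⟩
        refine ⟨⟨⟨p, (hW p).mem⟩, mem_connectedComponentIn hp⟩, ?_⟩
        refine isPreconnected_connectedComponentIn.preimage_of_isOpenMap
          Subtype.val_injective (W p).isOpen.isOpenMap_subtype_val ?_
        exact fun x hx => ⟨⟨x, (connectedComponentIn_subset _ _ hx).2⟩, rfl⟩
      isLSubmanifold := fun p => hN.connectedComponentIn_slice smooth_action p.2 (hW p)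
      isOpen_image := fun p => by
        obtain ⟨O, hO, hOV⟩ :=
          hN.submanifold.exists_isOpen_connectedComponentIn (W p).isOpen (p : M)
        obtain ⟨O', hO', h⟩ := exists_isOpen_image_eq_inter_range hN.invariant hemb hO
        refine ⟨O', hO', ?_⟩
        rw [← h, ← hOV]
        exact himage p
      iUnion_image := by
        refine Subset.antisymm (iUnion_subset fun p => ?_) ?_
        · refine (himage p).trans_subset ?_
          rintro _ ⟨x, hx, rfl⟩
          exact ⟨Quotient.mk _ ⟨x, (connectedComponentIn_subset _ _ hx).1⟩, rfl⟩
        · rintro _ ⟨⟨p⟩, rfl⟩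
          exact mem_iUnion.2 ⟨p, ⟨p, (hW p).mem⟩,
            mem_connectedComponentIn ⟨p.2, (hW p).mem⟩, rfl⟩ }
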